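/- Let $Q\in\mathbb{R}^{n\times n}$ be symmetric positive semidefinite, $c\in\mathbb{R}^n$, $a_1,\dots,a_m\in\mathbb{R}^n$ (the rows of $A$), $b\in\mathbb{R}^m$, $\mathcal B\subseteq[n]$, and let $$z(b)=\inf\{x^\top Qx+2c^\top x:\ a_i^\top x=b_i\ (i\in[m]),\ x\ge 0,\ x_j\in\{0,1\}\ (j\in\mathcal B)\}.\qquad\text{(MBQP)}$$ Assume that (MBQP) is feasible and that $x\ge 0$, $a_i^\top x=b_i$ for all $i$, imply $0\le x_j\le 1$ for all $j\in\mathcal B$. For $\epsilon\ge0$ let $\zeta(b,\epsilon)$ be the infimum of $x^\top Qx+2c^\top x$ over all $x\ge0$ for which there are $\varepsilon^{(1)},\varepsilon^{(2)}$ with $\|\varepsilon^{(1)}\|_\infty,\|\varepsilon^{(2)}\|_\infty\le\epsilon$, $a_i^\top x=b_i+\varepsilon^{(1)}_i$ for all $i$, and $x_j+\varepsilon^{(2)}_j\in\{0,1\}$ for all $j\in\mathcal B$. For a real $l\le z(b)$, call $t_1,t_2>0$ stability constants for $l$ if $\zeta(b,\epsilon)\ge l-t_2\epsilon$ for all $0\le\epsilon<t_1$.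 Define the symmetric $(n+1)\times(n+1)$ matrices, in block form with respect to $y=[t;x]$, $$C=\begin{bmatrix}0&c^\top\\c&Q\end{bmatrix},\ T=\begin{bmatrix}1&0\\0&0\end{bmatrix},\ A_i=\begin{bmatrix}0&a_i^\top\\a_i&0\end{bmatrix},\ AA_i=\begin{bmatrix}0&0\\0&a_ia_i^\top\end{bmatrix},\ N_j=\begin{bmatrix}0&-e_j^\top\\-e_j&2e_je_j^\top\end{bmatrix},$$ $$KK_i=b_i^2T-b_iA_i+AA_i,\quad G_j(f,g,r)=f\sum_{i}KK_i-gN_j+rT,\quad H=T+\sum_iAA_i,$$ $$U=C+f_1\sum_iKK_i+\sum_{j\in\mathcal B}G_j(f_2,g,r)+\tau H-lT .$$ A symmetric matrix $M$ is copositive if $y^\top My\ge0$ for all $y\ge0$. The copositive dual of (MBQP) is to maximize $-\sum_i(2b_i\alpha_i+b_i^2\beta_i)-\theta$ over real $\alpha_i,\beta_i$ $(i\in[m])$, $\gamma_j$ $(j\in\mathcal B)$ and $\theta$ such that $M=C+\sum_i(\alpha_iA_i+\beta_iAA_i)+\sum_{j\in\mathcal B}\gamma_jN_j+\theta T$ is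 copositive. For $j\in\mathcal B$ and $\delta,r,g>0$ put $$h_j(\delta)=\min_{x\ge0,\,x_j\ge\delta}\max_i|a_i^\top x|,\quad u_j(\delta)=\min_{x\ge0,\,x_j\ge1+\delta}\max_i|a_i^\top x-b_i|,$$ $$p_j(r,g)=\min\Bigl\{\tfrac{\psi}{v}:\ x\ge0,\ \psi\ge0,\ |a_i^\top x-b_i|\le\psi\ \forall i,\ x_j\ge1+v,\ v\ge\min\{\tfrac r{4g},1\}\Bigr\}.$$ Then there exist $t_1,t_2>0$, depending only on $A,b,c,Q,\mathcal B$, that are stability constants for every real $l\le z(b)$. Moreover there exist $\rho,\eta>0$, depending only on $A,b,c,Q,\mathcal B$, such that the following holds for every real $l\le z(b)$ and all stability constants $t_1,t_2$ for $l$. Let $\epsilon_0\in(0,t_1)$ and $r>0$. For all $j\in\mathcal B$ and $g>0$, the numbers $u_j(\epsilon_0)$, $h_j(1)$ and $p_j(r,g)$ are positive. Consider the rules 1. $g>0$ and $f_2\ge\max\bigl\{\frac{2g}{h_j(1)^2},\frac{2g}{p_j(r,g)^2},\frac{g^2+2rg}{r\,p_j(r,g)^2}\bigr\}$ for all $j\in\mathcal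 B$; 2. $\tau=t_2\epsilon_0$; 3. $f_1\ge\max\bigl\{\rho+l,\ \frac1{2\eta},\ \frac{\rho+l}{\epsilon_0^2},\ \max_{j\in\mathcal B}\frac{\rho+l}{u_j(\epsilon_0)^2}\bigr\}$; 4. $g\ge\frac{\rho+l}{\epsilon_0^2}$. There are $f_1,f_2,g,\tau$ that satisfy the rules, and for all $f_1,f_2,g,\tau$ that satisfy them, every $G_j(f_2,g,r)$ with $j\in\mathcal B$ is copositive, $U$ is copositive, and $U$ is the matrix $M$ of some multipliers of the copositive dual; all such multipliers have the objective value $$l-\tau\Bigl(1+\sum_ib_i^2\Bigr)-r|\mathcal B|.$$ With $\tau=t_2\epsilon_0$, this value tends to $l$ as $r\to0^+$ and $\epsilon_0\to0^+$. -/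

import Mathlib

open Matrix Filter Topology

noncomputable section

/-- Data of a mixed-binary quadratic program
`min xᵀ Q x + 2 cᵀ x` subject to `A x = b`, `x ≥ 0`, `x j ∈ {0, 1}` for `j ∈ B`.
The `i`-th row of `A` is the vector `aᵢ`. -/
structure MBQP (m n : ℕ) where
  Q : Matrix (Fin n) (Fin n) ℝ
  c : Fin n → ℝ
  A : Matrix (Fin m) (Fin n) ℝ
  b : Fin m → ℝ
  B : Finset (Fin n)

/-- A real matrix is copositive if it is symmetric and its quadratic form is nonnegative on the
nonnegative orthant. -/
def IsCopositive {κ : Type*} [Fintype κ] (M : Matrix κ κ ℝ) : Prop :=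
  M.IsSymm ∧ ∀ y : κ → ℝ, 0 ≤ y → 0 ≤ y ⬝ᵥ (M *ᵥ y)

namespace MBQP

variable {m n : ℕ} (P : MBQP m n)

/-- The objective function `xᵀ Q x + 2 cᵀ x`. -/
def objective (x : Fin n → ℝ) : ℝ := x ⬝ᵥ (P.Q *ᵥ x) + 2 * (P.c ⬝ᵥ x)

/-- The linear relaxation `{x ≥ 0 : A x = b}`. -/
def polyhedron : Set (Fin n → ℝ) := {x | 0 ≤ x ∧ P.A *ᵥ x = P.b}

/-- The feasible set of the mixed-binary program. -/
def feasible : Set (Fin n → ℝ) := {x | x ∈ P.polyhedron ∧ ∀ j ∈ P.B, x j = 0 ∨ x j = 1}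

/-- The optimal value `z(b)`, with values in the extended reals. -/
def optVal : EReal := ⨅ x ∈ P.feasible, (P.objective x : EReal)

/-- The standing assumption: on `{x ≥ 0 : A x = b}` the binary variables lie in `[0, 1]`. -/
def BinaryInUnitInterval : Prop := ∀ x ∈ P.polyhedron, ∀ j ∈ P.B, 0 ≤ x j ∧ x j ≤ 1

/-- The feasible set of the `ε`-perturbed program: `A x = b + ε⁽¹⁾` and `x j + ε⁽²⁾ j ∈ {0, 1}`
for `j ∈ B`, where both perturbations have sup norm at most `ε`. -/
def perturbedFeasible (ε : ℝ) : Set (Fin n → ℝ) :=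
  {x | 0 ≤ x ∧ ∃ (e₁ : Fin m → ℝ) (e₂ : P.B → ℝ),
    (∀ i, |e₁ i| ≤ ε) ∧ (∀ j, |e₂ j| ≤ ε) ∧
    P.A *ᵥ x = P.b + e₁ ∧ ∀ j : P.B, x j + e₂ j = 0 ∨ x j + e₂ j = 1}

/-- The optimal value `ζ(b, ε)` of the `ε`-perturbed program. -/
def perturbedVal (ε : ℝ) : EReal := ⨅ x ∈ P.perturbedFeasible ε, (P.objective x : EReal)

/-- `t₁, t₂` are local stability constants for the lower bound `l`:
`ζ(b, ε) ≥ l - t₂ ε` for all `0 ≤ ε < t₁`. -/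
def IsLocallyStable (l t₁ t₂ : ℝ) : Prop :=
  0 < t₁ ∧ 0 < t₂ ∧ ∀ ε : ℝ, 0 ≤ ε → ε < t₁ → ((l - t₂ * ε : ℝ) : EReal) ≤ P.perturbedVal ε

/-- `h_j(η) = min {max_i |aᵢᵀ x| : x ≥ 0, x j ≥ η}`. -/
def hConst (j : Fin n) (η : ℝ) : ℝ :=
  sInf {s : ℝ | 0 ≤ s ∧ ∃ x : Fin n → ℝ, 0 ≤ x ∧ η ≤ x j ∧ ∀ i, |(P.A *ᵥ x) i| ≤ s}

/-- `u_j(η) = min {max_i |aᵢᵀ x - bᵢ| : x ≥ 0, x j ≥ 1 + η}`. -/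
def uConst (j : Fin n) (η : ℝ) : ℝ :=
  sInf {s : ℝ | 0 ≤ s ∧ ∃ x : Fin n → ℝ, 0 ≤ x ∧ 1 + η ≤ x j ∧ ∀ i, |(P.A *ᵥ x) i - P.b i| ≤ s}

/-- `p_j = min {ψ / v : x ≥ 0, ψ ≥ 0, |aᵢᵀ x - bᵢ| ≤ ψ for all i, x j ≥ 1 + v,
v ≥ min {r / (4 g), 1}}`. -/
def pConst (j : Fin n) (r g : ℝ) : ℝ :=
  sInf {q : ℝ | ∃ (x : Fin n → ℝ) (ψ v : ℝ), 0 ≤ x ∧ 0 ≤ ψ ∧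
    (∀ i, |(P.A *ᵥ x) i - P.b i| ≤ ψ) ∧ 1 + v ≤ x j ∧ min (r / (4 * g)) 1 ≤ v ∧ q = ψ / v}

/-- The index `Sum.inl ()` carries the homogenizing coordinate `t`, the indices `Sum.inr j` carry
`x`. This is the block matrix `[0, cᵀ; c, Q]`. -/
def matC : Matrix (Unit ⊕ Fin n) (Unit ⊕ Fin n) ℝ :=
  fromBlocks 0 (replicateRow Unit P.c) (replicateCol Unit P.c) P.Q

/-- `T = [1, 0; 0, 0]`. -/
def matT (n : ℕ) : Matrix (Unit ⊕ Fin n) (Unit ⊕ Fin n) ℝ := fromBlocks 1 0 0 0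

/-- `Aᵢ = [0, aᵢᵀ; aᵢ, 0]`. -/
def matA (i : Fin m) : Matrix (Unit ⊕ Fin n) (Unit ⊕ Fin n) ℝ :=
  fromBlocks 0 (replicateRow Unit (P.A i)) (replicateCol Unit (P.A i)) 0

/-- `AAᵢ = [0, 0; 0, aᵢ aᵢᵀ]`. -/
def matAA (i : Fin m) : Matrix (Unit ⊕ Fin n) (Unit ⊕ Fin n) ℝ :=
  fromBlocks 0 0 0 (vecMulVec (P.A i) (P.A i))

/-- `N_j = [0, -e_jᵀ; -e_j, 2 e_j e_jᵀ]`. -/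
def matN (j : Fin n) : Matrix (Unit ⊕ Fin n) (Unit ⊕ Fin n) ℝ :=
  fromBlocks 0 (replicateRow Unit (-Pi.single j 1)) (replicateCol Unit (-Pi.single j 1))
    ((2 : ℝ) • vecMulVec (Pi.single j 1) (Pi.single j 1))

/-- `KKᵢ = bᵢ² T - bᵢ Aᵢ + AAᵢ`. -/
def matKK (i : Fin m) : Matrix (Unit ⊕ Fin n) (Unit ⊕ Fin n) ℝ :=
  P.b i ^ 2 • matT n - P.b i • P.matA i + P.matAA i

/-- `G_j(f, g, r) = f ∑ᵢ KKᵢ - g N_j + r T`. -/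
def matG (j : Fin n) (f g r : ℝ) : Matrix (Unit ⊕ Fin n) (Unit ⊕ Fin n) ℝ :=
  f • (∑ i, P.matKK i) - g • matN j + r • matT n

/-- `H = T + ∑ᵢ AAᵢ`. -/
def matH : Matrix (Unit ⊕ Fin n) (Unit ⊕ Fin n) ℝ := matT n + ∑ i, P.matAA i

/-- `U = C + f₁ ∑ᵢ KKᵢ + ∑_{j ∈ B} G_j(f₂, g, r) + τ H - l T`. -/
def matU (f₁ f₂ g r τ l : ℝ) : Matrix (Unit ⊕ Fin n) (Unit ⊕ Fin n) ℝ :=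
  P.matC + f₁ • (∑ i, P.matKK i) + (∑ j ∈ P.B, P.matG j f₂ g r) + τ • P.matH - l • matT n

/-- Multipliers of the copositive dual program
`max -∑ᵢ (2 bᵢ αᵢ + bᵢ² βᵢ) - θ` subject to
`C + ∑ᵢ (αᵢ Aᵢ + βᵢ AAᵢ) + ∑_{j ∈ B} γ_j N_j + θ T = M`, `M` copositive. -/
structure DualVar (P : MBQP m n) where
  α : Fin m → ℝ
  β : Fin m → ℝ
  γ : P.B → ℝ
  θ : ℝ

/-- The matrix `M` of the copositive dual attached to the multipliers. -/
def dualMatrix (d : P.DualVar) : Matrix (Unit ⊕ Fin n) (Unit ⊕ Fin n) ℝ :=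
  P.matC + (∑ i, (d.α i • P.matA i + d.β i • P.matAA i)) +
    (∑ j : P.B, d.γ j • matN (j : Fin n)) + d.θ • matT n

/-- The objective function of the copositive dual. -/
def dualObjective (d : P.DualVar) : ℝ :=
  -(∑ i, (2 * P.b i * d.α i + P.b i ^ 2 * d.β i)) - d.θ

/-- The rules that the penalty parameters have to satisfy. -/
structure PenaltyRules (P : MBQP m n) (ρ η l t₂ ε₀ r f₁ f₂ g τ : ℝ) : Prop where
  g_pos : 0 < g
  f₂_ge : ∀ j ∈ P.B,
    2 * g / P.hConst j 1 ^ 2 ≤ f₂ ∧ 2 * g / P.pConst j r g ^ 2 ≤ f₂ ∧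
    (g ^ 2 + 2 * r * g) / (r * P.pConst j r g ^ 2) ≤ f₂
  τ_eq : τ = t₂ * ε₀
  f₁_ge : ρ + l ≤ f₁ ∧ 1 / (2 * η) ≤ f₁ ∧ (ρ + l) / ε₀ ^ 2 ≤ f₁ ∧
    ∀ j ∈ P.B, (ρ + l) / P.uConst j ε₀ ^ 2 ≤ f₁
  g_ge : (ρ + l) / ε₀ ^ 2 ≤ g

end MBQP

end

section Hoffman

variable {ι κ : Type*} [Fintype ι] [Fintype κ]

theorem exists_conformal_bound (A : Matrix ι κ ℝ) :
    ∃ K : ℝ, 0 < K ∧ ∀ d : κ → ℝ, ∃ d' : κ → ℝ, A *ᵥ d' = A *ᵥ d ∧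
      (∀ i, d' i ∈ Set.uIcc 0 (d i)) ∧ ‖d'‖ ≤ K * ‖A *ᵥ d‖ := by
  classical
  let S : Set (κ → ℝ) := {w | ∀ w' : κ → ℝ, A *ᵥ w' = A *ᵥ w →
    (∀ i, w' i ∈ Set.uIcc 0 (w i)) → ∑ i, |w i| ≤ ∑ i, |w' i|}
  have hmin : ∀ d : κ → ℝ, ∃ d' ∈ S, A *ᵥ d' = A *ᵥ d ∧ ∀ i, d' i ∈ Set.uIcc 0 (d i) := by
    intro d
    have hc : IsCompact ((Set.univ.pi fun i => Set.uIcc 0 (d i)) ∩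
        {w : κ → ℝ | A *ᵥ w = A *ᵥ d}) :=
      (isCompact_univ_pi fun i => isCompact_uIcc).inter_right
        (isClosed_eq (by fun_prop) continuous_const)
    have hf : Continuous fun w : κ → ℝ => ∑ i, |w i| := by fun_prop
    obtain ⟨w, ⟨hw1, hw2⟩, hw⟩ := hc.exists_isMinOn
      ⟨d, fun i _ => Set.right_mem_uIcc, rfl⟩ hf.continuousOn
    refine ⟨w, fun w' h1 h2 => hw ⟨fun i hi => ?_, h1.trans hw2⟩, hw2, fun i => hw1 i trivial⟩
    exact Set.uIcc_subset_uIcc Set.left_mem_uIcc (hw1 i hi) (h2 i)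
  have hscale : ∀ w ∈ S, ∀ a : ℝ, 0 < a → a • w ∈ S := by
    intro w hw a ha w' h1 h2
    have key := hw (a⁻¹ • w') (by rw [mulVec_smul, h1, mulVec_smul, inv_smul_smul₀ ha.ne'])
      (fun i => by
        have := h2 i
        rw [Set.mem_uIcc] at this ⊢
        simp only [Pi.smul_apply, smul_eq_mul] at this ⊢
        rw [inv_mul_eq_div, le_div_iff₀ ha, div_le_iff₀ ha, le_div_iff₀ ha, div_le_iff₀ ha]
        rcases this with h | h
        · left; constructor <;> linarith
        · right; constructor <;> linarith)
    simp only [Pi.smul_apply, smul_eq_mul, abs_mul, abs_inv, abs_of_pos ha,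
      ← Finset.mul_sum] at key ⊢
    rwa [inv_mul_eq_div, le_div_iff₀ ha, mul_comm] at key
  have hcomp : IsCompact (closure (S ∩ Metric.sphere 0 1)) :=
    ((isCompact_sphere (0 : κ → ℝ) 1).closure_of_subset Set.inter_subset_right)
  have hpos : ∀ w ∈ closure (S ∩ Metric.sphere 0 1), 0 < ‖A *ᵥ w‖ := by
    intro w hw
    by_contra hcon
    have hAw : A *ᵥ w = 0 := by simpa using hcon
    have hw1 : ‖w‖ = 1 := by
      have : w ∈ Metric.sphere (0 : κ → ℝ) 1 :=
        closure_minimal Set.inter_subset_right Metric.isClosed_sphere hw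
      simpa using this
    have hnhds : {u : κ → ℝ | ∀ i, w i ≠ 0 → |u i - w i| < |w i| / 2} ∈ 𝓝 w := by
      rw [← Filter.Eventually, Filter.eventually_all]
      intro i
      by_cases hi : w i = 0
      · simp [hi]
      · have hcont : Continuous fun u : κ → ℝ => |u i - w i| := by fun_prop
        have := hcont.continuousAt.eventually_lt (x₀ := w)
          (continuousAt_const (y := |w i| / 2)) (by simpa using hi)
        filter_upwards [this] with u hu _ using hu
    obtain ⟨u, hu, huS, -⟩ := mem_closure_iff_nhds.1 hw _ hnhds
    have hbox : ∀ i, (u i - w i / 2) ∈ Set.uIcc 0 (u i) ∧ |u i - w i / 2| = |u i| - |w i| / 2 := by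
      intro i
      rcases lt_trichotomy (w i) 0 with h | h | h
      · have := hu i h.ne
        rw [abs_of_neg h, abs_lt] at this
        refine ⟨Set.mem_uIcc.2 (Or.inr ⟨by linarith, by linarith⟩), ?_⟩
        rw [abs_of_neg h, abs_of_neg (by linarith : u i < 0), abs_of_nonpos (by linarith)]
        ring
      · simp [h]
      · have := hu i h.ne'
        rw [abs_of_pos h, abs_lt] at this
        refine ⟨Set.mem_uIcc.2 (Or.inl ⟨by linarith, by linarith⟩), ?_⟩
        rw [abs_of_pos h, abs_of_pos (by linarith : 0 < u i), abs_of_nonneg (by linarith)]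
    have h1 := huS (fun i => u i - w i / 2)
      (by
        have : (fun i => u i - w i / 2) = u - (1 / 2 : ℝ) • w := by
          ext i; simp; ring
        rw [this, mulVec_sub, mulVec_smul, hAw]; simp)
      (fun i => (hbox i).1)
    simp only [fun i => (hbox i).2, Finset.sum_sub_distrib, ← Finset.sum_div] at h1
    have h2 : ∑ i, |w i| = 0 := le_antisymm (by linarith) (Finset.sum_nonneg fun i _ => abs_nonneg _)
    have h3 : w = 0 := by
      ext i
      simpa using (Finset.sum_eq_zero_iff_of_nonneg fun i _ => abs_nonneg (w i)).1 h2 i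
    simp [h3] at hw1
  have hcont : Continuous fun w : κ → ℝ => ‖A *ᵥ w‖ := by fun_prop
  obtain ⟨a, ha, hle⟩ := hcomp.exists_forall_le' hcont.continuousOn hpos
  refine ⟨a⁻¹, inv_pos.2 ha, fun d => ?_⟩
  obtain ⟨d', hS, h1, h2⟩ := hmin d
  refine ⟨d', h1, h2, ?_⟩
  rw [← h1, inv_mul_eq_div, le_div_iff₀ ha]
  rcases eq_or_ne d' 0 with h0 | h0
  · simp [h0]
  have hn : 0 < ‖d'‖ := norm_pos_iff.2 h0
  have := hle (‖d'‖⁻¹ • d') (subset_closure ⟨hscale _ hS _ (inv_pos.2 hn), by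
    simp [norm_smul, hn.ne']⟩)
  rw [mulVec_smul, norm_smul, norm_inv, norm_norm, inv_mul_eq_div, le_div_iff₀ hn] at this
  linarith

/-- Hoffman's error bound for a feasible system `y ≥ 0`, `M y = v`. -/
theorem exists_hoffman_bound (M : Matrix ι κ ℝ) (v : ι → ℝ)
    (hne : ∃ y : κ → ℝ, 0 ≤ y ∧ M *ᵥ y = v) :
    ∃ K : ℝ, 0 < K ∧ ∀ x : κ → ℝ, 0 ≤ x →
      ∃ y : κ → ℝ, 0 ≤ y ∧ M *ᵥ y = v ∧ ‖y - x‖ ≤ K * ‖M *ᵥ x - v‖ := by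
  obtain ⟨K, hK, h⟩ := exists_conformal_bound M
  obtain ⟨z, hz, hMz⟩ := hne
  refine ⟨K, hK, fun x hx => ?_⟩
  obtain ⟨d, hd, hbox, hn⟩ := h (z - x)
  refine ⟨x + d, fun i => ?_, ?_, ?_⟩
  · have h1 := hx i
    have h2 := hz i
    have := hbox i
    simp only [Pi.zero_apply, Pi.add_apply, Pi.sub_apply, Set.mem_uIcc] at *
    rcases this with h | h <;> linarith
  · rw [mulVec_add, hd, mulVec_sub, hMz]; abel
  · rw [mulVec_sub, hMz, norm_sub_rev] at hn
    simpa using hn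

theorem exists_local_hoffman_bound (M : Matrix ι κ ℝ) (v : ι → ℝ) :
    ∃ K t : ℝ, 0 < K ∧ 0 < t ∧ ∀ x : κ → ℝ, 0 ≤ x → ‖M *ᵥ x - v‖ < t →
      ∃ y : κ → ℝ, 0 ≤ y ∧ M *ᵥ y = v ∧ ‖y - x‖ ≤ K * ‖M *ᵥ x - v‖ := by
  by_cases hne : ∃ y : κ → ℝ, 0 ≤ y ∧ M *ᵥ y = v
  · obtain ⟨K, hK, h⟩ := exists_hoffman_bound M v hne
    exact ⟨K, 1, hK, one_pos, fun x hx _ => h x hx⟩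
  push Not at hne
  obtain ⟨K, hK, h⟩ := exists_conformal_bound M
  have hc : IsCompact (Set.Ici (0 : κ → ℝ) ∩ Metric.closedBall 0 (K * (‖v‖ + 1))) :=
    (isCompact_closedBall _ _).inter_left isClosed_Ici
  have hcont : Continuous fun w : κ → ℝ => ‖M *ᵥ w - v‖ := by fun_prop
  obtain ⟨a, ha, hle⟩ := hc.exists_forall_le' hcont.continuousOn (a := 0)
    (fun w hw => norm_pos_iff.2 (sub_ne_zero.2 (hne w hw.1)))
  refine ⟨1, min a 1, one_pos, lt_min ha one_pos, fun x hx hlt => ?_⟩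
  obtain ⟨d, hd, hbox, hn⟩ := h x
  have hMx : ‖M *ᵥ x‖ ≤ ‖v‖ + 1 := by
    have h1 := norm_le_norm_add_norm_sub v (M *ᵥ x)
    rw [norm_sub_rev] at h1
    linarith [min_le_right a 1]
  have := hle d ⟨fun i => by
      have h1 := hbox i
      have h2 := hx i
      simp only [Pi.zero_apply] at h2
      rw [Set.uIcc_of_le h2] at h1
      exact h1.1, by
      rw [mem_closedBall_zero_iff]
      exact hn.trans (by gcongr)⟩
  rw [hd] at this
  linarith [min_le_left a 1]

theorem abs_dotProduct_le_card_mul_norm (u v : κ → ℝ) :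
    |u ⬝ᵥ v| ≤ Fintype.card κ * (‖u‖ * ‖v‖) := by
  calc |u ⬝ᵥ v| ≤ ∑ i, |u i * v i| := Finset.abs_sum_le_sum_abs _ _
    _ ≤ ∑ _i : κ, ‖u‖ * ‖v‖ := by
        refine Finset.sum_le_sum fun i _ => ?_
        rw [abs_mul]
        exact mul_le_mul (norm_le_pi_norm u i) (norm_le_pi_norm v i) (abs_nonneg _)
          (norm_nonneg _)
    _ = _ := by simp

theorem exists_norm_mulVec_le (A : Matrix ι κ ℝ) :
    ∃ C : ℝ, 0 < C ∧ ∀ x : κ → ℝ, ‖A *ᵥ x‖ ≤ C * ‖x‖ := by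
  obtain ⟨C, hC, h⟩ := (LinearMap.toContinuousLinearMap A.mulVecLin).bound
  exact ⟨C, hC, fun x => by simpa using h x⟩

theorem norm_sq_le_sum_sq (u : κ → ℝ) : ‖u‖ ^ 2 ≤ ∑ i, u i ^ 2 := by
  have h0 : 0 ≤ ∑ i, u i ^ 2 := Finset.sum_nonneg fun i _ => sq_nonneg _
  have : ‖u‖ ≤ √(∑ i, u i ^ 2) := by
    rw [pi_norm_le_iff_of_nonneg (Real.sqrt_nonneg _)]
    intro i
    apply Real.le_sqrt_of_sq_le
    rw [Real.norm_eq_abs, sq_abs]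
    exact Finset.single_le_sum (f := fun i => u i ^ 2) (fun i _ => sq_nonneg _) (Finset.mem_univ i)
  calc ‖u‖ ^ 2 ≤ √(∑ i, u i ^ 2) ^ 2 := by gcongr
    _ = _ := Real.sq_sqrt h0

open scoped MatrixOrder Matrix.Norms.L2Operator in
theorem Matrix.PosSemidef.exists_conjTranspose_mul_self {Q : Matrix κ κ ℝ} (hQ : Q.PosSemidef) :
    ∃ R : Matrix κ κ ℝ, Q = Rᴴ * R := by
  classical
  exact CStarAlgebra.nonneg_iff_eq_star_mul_self.mp hQ.nonneg

theorem Matrix.PosSemidef.exists_norm_mulVec_sq_le {Q : Matrix κ κ ℝ} (hQ : Q.PosSemidef) :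
    ∃ L : ℝ, 0 < L ∧ ∀ x : κ → ℝ, ‖Q *ᵥ x‖ ^ 2 ≤ L * (x ⬝ᵥ (Q *ᵥ x)) := by
  classical
  obtain ⟨R, hR⟩ := hQ.exists_conjTranspose_mul_self
  rw [conjTranspose_eq_transpose_of_trivial] at hR
  obtain ⟨C, hC, h⟩ := exists_norm_mulVec_le Rᵀ
  refine ⟨C ^ 2, by positivity, fun x => ?_⟩
  have h1 : x ⬝ᵥ (Q *ᵥ x) = ∑ i, (R *ᵥ x) i ^ 2 := by
    rw [hR, ← mulVec_mulVec, dotProduct_mulVec, vecMul_transpose]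
    simp [dotProduct, sq]
  rw [h1]
  calc ‖Q *ᵥ x‖ ^ 2 ≤ (C * ‖R *ᵥ x‖) ^ 2 := by
        rw [hR, ← mulVec_mulVec]
        gcongr
        exact h _
    _ = C ^ 2 * ‖R *ᵥ x‖ ^ 2 := by ring
    _ ≤ _ := by gcongr; exact norm_sq_le_sum_sq _

end Hoffman

namespace MBQP
variable {m n : ℕ} (P : MBQP m n)

/-- Recession directions of the relaxation leave the binary variables unchanged. -/
theorem recession_binary_eq_zero (hB : P.BinaryInUnitInterval) {x₀ d : Fin n → ℝ}
    (hx₀ : x₀ ∈ P.polyhedron) (hd : 0 ≤ d) (hAd : P.A *ᵥ d = 0) {j : Fin n} (hj : j ∈ P.B) :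
    d j = 0 := by
  refine le_antisymm (le_of_not_gt fun h => ?_) (hd j)
  have h1 := (hB (x₀ + (2 / d j) • d) ⟨add_nonneg hx₀.1 (smul_nonneg (by positivity) hd), by
    rw [mulVec_add, mulVec_smul, hAd, hx₀.2]; simp⟩ j hj).2
  have h2 := hx₀.1 j
  simp [h.ne'] at h1 h2
  linarith

/-- A finite lower bound forces the objective to be nonnegative along recession directions in the
kernel of `Q`. -/
theorem recession_cost_nonneg (hB : P.BinaryInUnitInterval) (hfeas : P.feasible.Nonempty)
    {l : ℝ} (hl : ∀ x ∈ P.feasible, l ≤ P.objective x) (hQ : P.Q.IsSymm)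
    {d : Fin n → ℝ} (hd : 0 ≤ d) (hAd : P.A *ᵥ d = 0) (hQd : P.Q *ᵥ d = 0) :
    0 ≤ P.c ⬝ᵥ d := by
  obtain ⟨x₀, hx₀, hbin⟩ := hfeas
  by_contra! hneg
  set s : ℝ := (|P.objective x₀ - l| + 1) / (-(P.c ⬝ᵥ d)) with hs
  have hs0 : 0 < s := div_pos (by positivity) (by linarith)
  have hsc : s * (P.c ⬝ᵥ d) = -(|P.objective x₀ - l| + 1) := by
    have := hneg.ne
    rw [hs]; field_simp
  have hmem : x₀ + s • d ∈ P.feasible := by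
    refine ⟨⟨add_nonneg hx₀.1 (smul_nonneg hs0.le hd), ?_⟩, fun j hj => ?_⟩
    · rw [mulVec_add, mulVec_smul, hAd, hx₀.2]; simp
    · have := P.recession_binary_eq_zero hB hx₀ hd hAd hj
      simpa [this] using hbin j hj
  have h1 := hl _ hmem
  have hdQ : d ⬝ᵥ (P.Q *ᵥ x₀) = 0 := by
    rw [dotProduct_mulVec, ← mulVec_transpose, hQ.eq, hQd, zero_dotProduct]
  have h2 : P.objective (x₀ + s • d) = P.objective x₀ + 2 * (s * (P.c ⬝ᵥ d)) := by
    simp only [objective, mulVec_add, mulVec_smul, hQd, smul_zero, add_zero, add_dotProduct,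
      smul_dotProduct, hdQ, dotProduct_add, dotProduct_smul, smul_eq_mul, mul_zero]
    ring
  rw [h2, hsc] at h1
  have := le_abs_self (P.objective x₀ - l)
  have := abs_nonneg (P.objective x₀ - l)
  linarith

theorem exists_neg_le_cost
    (hrec : ∀ d : Fin n → ℝ, 0 ≤ d → P.A *ᵥ d = 0 → P.Q *ᵥ d = 0 → 0 ≤ P.c ⬝ᵥ d) :
    ∃ C : ℝ, 0 < C ∧ ∀ x : Fin n → ℝ, 0 ≤ x →
      -(C * (‖P.A *ᵥ x‖ + ‖P.Q *ᵥ x‖)) ≤ P.c ⬝ᵥ x := by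
  obtain ⟨K, hK, h⟩ := exists_conformal_bound (fromRows P.A P.Q)
  refine ⟨n * ‖P.c‖ * K + 1, by positivity, fun x hx => ?_⟩
  obtain ⟨d, hd, hbox, hn⟩ := h x
  simp only [fromRows_mulVec] at hd hn
  have hA : P.A *ᵥ d = P.A *ᵥ x := funext fun i => congrFun hd (Sum.inl i)
  have hQ : P.Q *ᵥ d = P.Q *ᵥ x := funext fun i => congrFun hd (Sum.inr i)
  have hle : ‖Sum.elim (P.A *ᵥ x) (P.Q *ᵥ x)‖ ≤ ‖P.A *ᵥ x‖ + ‖P.Q *ᵥ x‖ := by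
    rw [pi_norm_le_iff_of_nonneg (by positivity)]
    rintro (i | i)
    · exact (norm_le_pi_norm (P.A *ᵥ x) i).trans (by simp)
    · exact (norm_le_pi_norm (P.Q *ᵥ x) i).trans (by simp)
  have h1 : 0 ≤ P.c ⬝ᵥ (x - d) := by
    refine hrec _ (fun i => ?_) (by rw [mulVec_sub, hA, sub_self]) (by rw [mulVec_sub, hQ, sub_self])
    have := hbox i
    rw [Set.uIcc_of_le (by simpa using hx i)] at this
    simpa using this.2
  rw [dotProduct_sub] at h1
  have h2 := (abs_le.1 (abs_dotProduct_le_card_mul_norm P.c d)).1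
  rw [Fintype.card_fin] at h2
  have h3 : n * (‖P.c‖ * ‖d‖) ≤ (n * ‖P.c‖ * K) * (‖P.A *ᵥ x‖ + ‖P.Q *ᵥ x‖) := by
    calc n * (‖P.c‖ * ‖d‖) ≤ n * (‖P.c‖ * (K * (‖P.A *ᵥ x‖ + ‖P.Q *ᵥ x‖))) := by
          gcongr
          exact hn.trans (by gcongr)
      _ = _ := by ring
  have h4 : 0 ≤ ‖P.A *ᵥ x‖ + ‖P.Q *ᵥ x‖ := by positivity
  linarith

/-- The objective is bounded below in terms of `‖Q x‖` and the residual of `A x = b`. -/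
theorem exists_objective_lower_bound (hQ : P.Q.PosSemidef)
    (hrec : ∀ d : Fin n → ℝ, 0 ≤ d → P.A *ᵥ d = 0 → P.Q *ᵥ d = 0 → 0 ≤ P.c ⬝ᵥ d) :
    ∃ κ R : ℝ, 0 < κ ∧ 0 < R ∧ ∀ x : Fin n → ℝ, 0 ≤ x →
      κ * ‖P.Q *ᵥ x‖ ^ 2 - R ≤ P.objective x + 1 / 2 * ‖P.A *ᵥ x - P.b‖ ^ 2 := by
  obtain ⟨L, hL, h1⟩ := hQ.exists_norm_mulVec_sq_le
  obtain ⟨C, hC, h2⟩ := P.exists_neg_le_cost hrec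
  refine ⟨1 / (2 * L), 2 * C ^ 2 * L + 2 * C ^ 2 + 2 * C * ‖P.b‖, by positivity, by positivity,
    fun x hx => ?_⟩
  have h3 : ‖P.Q *ᵥ x‖ ^ 2 / L ≤ x ⬝ᵥ (P.Q *ᵥ x) := by
    rw [div_le_iff₀ hL]; linarith [h1 x]
  have h4 := h2 x hx
  have h5 : C * ‖P.A *ᵥ x‖ ≤ C * (‖P.b‖ + ‖P.A *ᵥ x - P.b‖) := by
    gcongr
    have := norm_add_le P.b (P.A *ᵥ x - P.b)
    simpa using this
  have h6 : 0 ≤ (‖P.Q *ᵥ x‖ - 2 * C * L) ^ 2 / (2 * L) := by positivity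
  have h7 : (‖P.Q *ᵥ x‖ - 2 * C * L) ^ 2 / (2 * L) =
      ‖P.Q *ᵥ x‖ ^ 2 / L - 1 / (2 * L) * ‖P.Q *ᵥ x‖ ^ 2 - 2 * C * ‖P.Q *ᵥ x‖ +
        2 * C ^ 2 * L := by
    field_simp; ring
  have h8 := sq_nonneg (‖P.A *ᵥ x - P.b‖ - 2 * C)
  rw [objective]
  nlinarith

/-- The perturbation of the objective is linear in the displacement while `Q x` stays bounded. -/
theorem exists_objective_displacement_bound (hQ : P.Q.IsSymm) (q K : ℝ) (hq : 0 ≤ q)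
    (hK : 0 ≤ K) :
    ∃ C : ℝ, 0 < C ∧ ∀ x y : Fin n → ℝ, ∀ ε : ℝ, ‖P.Q *ᵥ x‖ ≤ q → 0 ≤ ε → ε ≤ 1 →
      ‖y - x‖ ≤ K * ε → P.objective y ≤ P.objective x + C * ε := by
  obtain ⟨D, hD, hbd⟩ := exists_norm_mulVec_le P.Q
  refine ⟨n * (2 * q + D * K + 2 * ‖P.c‖) * K + 1, by positivity, fun x y ε hx hε hε1 hyx => ?_⟩
  obtain ⟨d, rfl⟩ : ∃ d, y = x + d := ⟨y - x, by simp⟩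
  rw [add_sub_cancel_left] at hyx
  have hsym : x ⬝ᵥ (P.Q *ᵥ d) = d ⬝ᵥ (P.Q *ᵥ x) := by
    rw [dotProduct_mulVec, ← mulVec_transpose, hQ.eq, dotProduct_comm]
  have h1 : P.objective (x + d) = P.objective x + d ⬝ᵥ ((2 : ℝ) • (P.Q *ᵥ x) + P.Q *ᵥ d +
      (2 : ℝ) • P.c) := by
    simp only [objective, mulVec_add, add_dotProduct, dotProduct_add, dotProduct_smul, hsym,
      smul_eq_mul, dotProduct_comm d P.c]
    ring
  have h2 := (le_abs_self _).trans (abs_dotProduct_le_card_mul_norm d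
    ((2 : ℝ) • (P.Q *ᵥ x) + P.Q *ᵥ d + (2 : ℝ) • P.c))
  have h3 : ‖(2 : ℝ) • (P.Q *ᵥ x) + P.Q *ᵥ d + (2 : ℝ) • P.c‖ ≤ 2 * q + D * K + 2 * ‖P.c‖ := by
    refine (norm_add₃_le).trans ?_
    have h4 : ‖P.Q *ᵥ d‖ ≤ D * K := (hbd d).trans (by
      gcongr
      exact hyx.trans (mul_le_of_le_one_right hK hε1))
    simp only [norm_smul, Real.norm_ofNat]
    linarith
  have h5 : ‖d‖ * ‖(2 : ℝ) • (P.Q *ᵥ x) + P.Q *ᵥ d + (2 : ℝ) • P.c‖ ≤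
      (K * ε) * (2 * q + D * K + 2 * ‖P.c‖) :=
    mul_le_mul hyx h3 (norm_nonneg _) (by positivity)
  rw [Fintype.card_fin] at h2
  have h6 := mul_le_mul_of_nonneg_left h5 (Nat.cast_nonneg (α := ℝ) n)
  rw [h1]
  linarith

theorem le_optVal_iff {l : ℝ} :
    (l : EReal) ≤ P.optVal ↔ ∀ x ∈ P.feasible, l ≤ P.objective x := by
  simp [optVal]

theorem le_perturbedVal_iff {l ε : ℝ} :
    (l : EReal) ≤ P.perturbedVal ε ↔ ∀ x ∈ P.perturbedFeasible ε, l ≤ P.objective x := by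
  simp only [perturbedVal, le_iInf_iff, EReal.coe_le_coe_iff]

theorem objective_le_of_isLocallyStable {l t₁ t₂ : ℝ} (h : P.IsLocallyStable l t₁ t₂) {ε : ℝ}
    (h0 : 0 ≤ ε) (h1 : ε < t₁) {x : Fin n → ℝ} (hx : x ∈ P.perturbedFeasible ε) :
    l - t₂ * ε ≤ P.objective x :=
  P.le_perturbedVal_iff.1 (h.2.2 ε h0 h1) x hx

/-- Points that are feasible up to a small error are close to feasible points. -/
theorem exists_feasible_near :
    ∃ K t : ℝ, 0 < K ∧ 0 < t ∧ ∀ ε : ℝ, 0 ≤ ε → ε < t → ∀ x ∈ P.perturbedFeasible ε,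
      ∃ y ∈ P.feasible, ‖y - x‖ ≤ K * ε := by
  let M : Matrix (Fin m ⊕ P.B) (Fin n) ℝ :=
    fromRows P.A (Matrix.of fun j : P.B => Pi.single (j : Fin n) (1 : ℝ))
  have hM : ∀ x : Fin n → ℝ, M *ᵥ x = Sum.elim (P.A *ᵥ x) fun j : P.B => x j := by
    intro x
    rw [fromRows_mulVec]
    congr 1
    ext j
    simp [mulVec]
  let v : (P.B → Bool) → Fin m ⊕ P.B → ℝ := fun σ => Sum.elim P.b fun j => if σ j then 1 else 0
  choose K t hK ht h using fun σ => exists_local_hoffman_bound M (v σ)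
  obtain ⟨σ₀, hσ₀⟩ := Finite.exists_min t
  obtain ⟨σ₁, hσ₁⟩ := Finite.exists_max K
  refine ⟨K σ₁, t σ₀, hK _, ht _, fun ε hε hεt x hx => ?_⟩
  obtain ⟨hx0, e₁, e₂, he₁, he₂, hA, hbin⟩ := hx
  classical
  let σ : P.B → Bool := fun j => decide (x j + e₂ j = 1)
  have hσ : ∀ j : P.B, x j + e₂ j = if σ j then 1 else 0 := by
    intro j
    rcases hbin j with h | h <;> simp [σ, h]
  have hnorm : ‖M *ᵥ x - v σ‖ ≤ ε := by
    rw [hM, pi_norm_le_iff_of_nonneg hε]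
    rintro (i | j)
    · simpa [v, hA] using he₁ i
    · have : x j - (if σ j then 1 else 0) = -e₂ j := by rw [← hσ]; ring
      simp only [v, Pi.sub_apply, Sum.elim_inr, this, norm_neg]
      exact he₂ j
  obtain ⟨y, hy0, hy, hyx⟩ := h σ x hx0 (hnorm.trans_lt (hεt.trans_le (hσ₀ σ)))
  rw [hM] at hy
  refine ⟨y, ⟨⟨hy0, funext fun i => congrFun hy (Sum.inl i)⟩, fun j hj => ?_⟩, ?_⟩
  · have := congrFun hy (Sum.inr ⟨j, hj⟩)
    simp only [v, Sum.elim_inr] at this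
    rw [this]
    split_ifs <;> simp
  · calc ‖y - x‖ ≤ K σ * ‖M *ᵥ x - v σ‖ := hyx
      _ ≤ K σ₁ * ε := mul_le_mul (hσ₁ σ) hnorm (norm_nonneg _) (hK _).le

theorem exists_stability_constants (hQ : P.Q.PosSemidef) (hB : P.BinaryInUnitInterval)
    (hfeas : P.feasible.Nonempty) :
    ∃ t₁ t₂ : ℝ, 0 < t₁ ∧ 0 < t₂ ∧
      ∀ l : ℝ, (l : EReal) ≤ P.optVal → P.IsLocallyStable l t₁ t₂ := by
  by_cases hex : ∃ l : ℝ, (l : EReal) ≤ P.optVal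
  swap
  · exact ⟨1, 1, one_pos, one_pos, fun l hl => (hex ⟨l, hl⟩).elim⟩
  obtain ⟨l₀, hl₀⟩ := hex
  rw [le_optVal_iff] at hl₀
  have hsymm : P.Q.IsSymm := by simpa using hQ.isHermitian
  obtain ⟨κ, R, hκ, hR, hlow⟩ := P.exists_objective_lower_bound hQ fun d h1 h2 h3 =>
    P.recession_cost_nonneg hB hfeas hl₀ hsymm h1 h2 h3
  obtain ⟨K, t, hK, ht, hnear⟩ := P.exists_feasible_near
  obtain ⟨x₀, hx₀⟩ := hfeas
  obtain ⟨C, hC, hdisp⟩ := P.exists_objective_displacement_bound hsymm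
    (√((|P.objective x₀| + R + 1) / κ)) K (Real.sqrt_nonneg _) hK.le
  refine ⟨min t 1, C, lt_min ht one_pos, hC, fun l hl => ⟨lt_min ht one_pos, hC,
    fun ε hε hεt => ?_⟩⟩
  rw [le_optVal_iff] at hl
  rw [le_perturbedVal_iff]
  intro x hx
  have hε1 : ε ≤ 1 := (hεt.trans_le (min_le_right _ _)).le
  have hCε : 0 ≤ C * ε := by positivity
  rcases le_total (P.objective x₀) (P.objective x) with hle | hle
  · linarith [hl x₀ hx₀]
  obtain ⟨y, hy, hyx⟩ := hnear ε hε (hεt.trans_le (min_le_left _ _)) x hx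
  have hres : ‖P.A *ᵥ x - P.b‖ ≤ 1 := by
    obtain ⟨-, e₁, -, he₁, -, hA, -⟩ := hx
    rw [hA, add_sub_cancel_left, pi_norm_le_iff_of_nonneg zero_le_one]
    exact fun i => (he₁ i).trans hε1
  have hq : ‖P.Q *ᵥ x‖ ≤ √((|P.objective x₀| + R + 1) / κ) := by
    apply Real.le_sqrt_of_sq_le
    rw [le_div_iff₀ hκ]
    have h1 := hlow x hx.1
    have h2 : ‖P.A *ᵥ x - P.b‖ ^ 2 ≤ 1 := pow_le_one₀ (norm_nonneg _) hres
    have h3 := le_abs_self (P.objective x₀)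
    linarith
  linarith [hdisp x y ε hq hε hε1 hyx, hl y hy]

section Constants

variable (hB : P.BinaryInUnitInterval) (hne : P.polyhedron.Nonempty)
include hB hne

theorem exists_violation_le_residual :
    ∃ K : ℝ, 0 < K ∧ ∀ x : Fin n → ℝ, 0 ≤ x → ∀ j ∈ P.B,
      x j - 1 ≤ K * ‖P.A *ᵥ x - P.b‖ := by
  obtain ⟨K, hK, h⟩ := exists_hoffman_bound P.A P.b hne
  refine ⟨K, hK, fun x hx j hj => ?_⟩
  obtain ⟨y, hy0, hy, hyx⟩ := h x hx
  have h1 := (hB y ⟨hy0, hy⟩ j hj).2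
  have h2 := (norm_le_pi_norm (y - x) j).trans hyx
  rw [Pi.sub_apply, Real.norm_eq_abs] at h2
  linarith [neg_abs_le (y j - x j)]

theorem exists_binary_le_norm_mulVec :
    ∃ K : ℝ, 0 < K ∧ ∀ x : Fin n → ℝ, 0 ≤ x → ∀ j ∈ P.B, x j ≤ K * ‖P.A *ᵥ x‖ := by
  obtain ⟨K, hK, h⟩ := exists_hoffman_bound P.A 0 ⟨0, le_rfl, mulVec_zero _⟩
  obtain ⟨x₀, hx₀⟩ := hne
  refine ⟨K, hK, fun x hx j hj => ?_⟩
  obtain ⟨y, hy0, hy, hyx⟩ := h x hx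
  have h1 := P.recession_binary_eq_zero hB hx₀ hy0 hy hj
  have h2 := (norm_le_pi_norm (y - x) j).trans hyx
  rw [Pi.sub_apply, Real.norm_eq_abs, sub_zero] at h2
  linarith [neg_abs_le (y j - x j)]

theorem uConst_pos {j : Fin n} (hj : j ∈ P.B) {δ : ℝ} (hδ : 0 < δ) : 0 < P.uConst j δ := by
  obtain ⟨K, hK, h⟩ := P.exists_violation_le_residual hB hne
  refine (div_pos hδ hK).trans_le (le_csInf ?_ ?_)
  · exact ⟨‖P.A *ᵥ (fun _ => 1 + δ) - P.b‖, norm_nonneg _, fun _ => 1 + δ,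
      fun _ => by simp; positivity, le_rfl,
      fun i => norm_le_pi_norm (P.A *ᵥ (fun _ => 1 + δ) - P.b) i⟩
  · rintro s ⟨hs, x, hx, hxj, hi⟩
    have h1 : ‖P.A *ᵥ x - P.b‖ ≤ s := (pi_norm_le_iff_of_nonneg hs).2 hi
    rw [div_le_iff₀ hK]
    nlinarith [h x hx j hj]

theorem hConst_pos {j : Fin n} (hj : j ∈ P.B) {δ : ℝ} (hδ : 0 < δ) : 0 < P.hConst j δ := by
  obtain ⟨K, hK, h⟩ := P.exists_binary_le_norm_mulVec hB hne
  refine (div_pos hδ hK).trans_le (le_csInf ?_ ?_)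
  · exact ⟨‖P.A *ᵥ (fun _ => δ)‖, norm_nonneg _, fun _ => δ, fun _ => hδ.le, le_rfl,
      fun i => norm_le_pi_norm (P.A *ᵥ (fun _ => δ)) i⟩
  · rintro s ⟨hs, x, hx, hxj, hi⟩
    have h1 : ‖P.A *ᵥ x‖ ≤ s := (pi_norm_le_iff_of_nonneg hs).2 hi
    rw [div_le_iff₀ hK]
    nlinarith [h x hx j hj]

theorem pConst_pos {j : Fin n} (hj : j ∈ P.B) {r g : ℝ} (hr : 0 < r) (hg : 0 < g) :
    0 < P.pConst j r g := by
  obtain ⟨K, hK, h⟩ := P.exists_violation_le_residual hB hne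
  have hmin : 0 < min (r / (4 * g)) 1 := lt_min (by positivity) one_pos
  refine (inv_pos.2 hK).trans_le (le_csInf ?_ ?_)
  · exact ⟨_, fun _ => 1 + 1, ‖P.A *ᵥ (fun _ => 1 + 1) - P.b‖, 1,
      fun _ => by norm_num, norm_nonneg _,
      fun i => norm_le_pi_norm (P.A *ᵥ (fun _ => 1 + 1) - P.b) i, le_rfl, min_le_right _ _, rfl⟩
  · rintro _ ⟨x, ψ, v, hx, hψ, hi, hxj, hv, rfl⟩
    have h1 : ‖P.A *ᵥ x - P.b‖ ≤ ψ := (pi_norm_le_iff_of_nonneg hψ).2 hi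
    rw [le_div_iff₀ (hmin.trans_le hv), inv_mul_le_iff₀ hK]
    nlinarith [h x hx j hj]

end Constants

theorem uConst_le {j : Fin n} {δ : ℝ} {x : Fin n → ℝ} (hx : 0 ≤ x) (hxj : 1 + δ ≤ x j) :
    P.uConst j δ ≤ ‖P.A *ᵥ x - P.b‖ :=
  csInf_le ⟨0, fun _ h => h.1⟩
    ⟨norm_nonneg _, x, hx, hxj, fun i => norm_le_pi_norm (P.A *ᵥ x - P.b) i⟩

theorem hConst_le {j : Fin n} {δ : ℝ} {x : Fin n → ℝ} (hx : 0 ≤ x) (hxj : δ ≤ x j) :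
    P.hConst j δ ≤ ‖P.A *ᵥ x‖ :=
  csInf_le ⟨0, fun _ h => h.1⟩
    ⟨norm_nonneg _, x, hx, hxj, fun i => norm_le_pi_norm (P.A *ᵥ x) i⟩

theorem pConst_le {j : Fin n} {r g v : ℝ} (hr : 0 < r) (hg : 0 < g) {x : Fin n → ℝ}
    (hx : 0 ≤ x) (hxj : 1 + v ≤ x j) (hv : min (r / (4 * g)) 1 ≤ v) :
    P.pConst j r g ≤ ‖P.A *ᵥ x - P.b‖ / v := by
  have hmin : 0 < min (r / (4 * g)) 1 := lt_min (by positivity) one_pos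
  refine csInf_le ⟨0, ?_⟩ ⟨x, ‖P.A *ᵥ x - P.b‖, v, hx, norm_nonneg _,
    fun i => norm_le_pi_norm (P.A *ᵥ x - P.b) i, hxj, hv, rfl⟩
  rintro _ ⟨_, _, _, _, hψ, _, _, hv, rfl⟩
  exact div_nonneg hψ (hmin.trans_le hv).le

section QuadraticForms

variable (t : ℝ) (x : Fin n → ℝ)

theorem quad_matC : Sum.elim (fun _ : Unit => t) x ⬝ᵥ (P.matC *ᵥ Sum.elim (fun _ => t) x) =
    x ⬝ᵥ (P.Q *ᵥ x) + 2 * t * (P.c ⬝ᵥ x) := by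
  rw [matC, fromBlocks_mulVec, Sum.elim_comp_inl, Sum.elim_comp_inr, sumElim_dotProduct_sumElim, dotProduct_add]
  have h1 : (replicateCol Unit P.c *ᵥ fun _ => t) = t • P.c := by
    ext i; simp [mulVec, dotProduct, mul_comm]
  have h2 : (replicateRow Unit P.c *ᵥ x) = fun _ => P.c ⬝ᵥ x := by
    ext i; simp [mulVec, dotProduct]
  rw [h1, h2, dotProduct_add x, dotProduct_smul, dotProduct_comm x P.c]
  simp [dotProduct]
  ring

theorem quad_matT : Sum.elim (fun _ : Unit => t) x ⬝ᵥ (matT n *ᵥ Sum.elim (fun _ => t) x) =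
    t ^ 2 := by
  rw [matT, fromBlocks_mulVec, Sum.elim_comp_inl, Sum.elim_comp_inr, sumElim_dotProduct_sumElim]
  simp [dotProduct, sq]

theorem quad_matA (i : Fin m) :
    Sum.elim (fun _ : Unit => t) x ⬝ᵥ (P.matA i *ᵥ Sum.elim (fun _ => t) x) =
      2 * t * (P.A *ᵥ x) i := by
  rw [matA, fromBlocks_mulVec, Sum.elim_comp_inl, Sum.elim_comp_inr, sumElim_dotProduct_sumElim, dotProduct_add]
  have h1 : (replicateCol Unit (P.A i) *ᵥ fun _ => t) = t • P.A i := by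
    ext i; simp [mulVec, dotProduct, mul_comm]
  have h2 : (replicateRow Unit (P.A i) *ᵥ x) = fun _ => (P.A *ᵥ x) i := by
    ext i; simp [mulVec, dotProduct]
  rw [h1, h2, dotProduct_add x, dotProduct_smul, dotProduct_comm x]
  simp [dotProduct, mulVec]
  ring

theorem quad_matAA (i : Fin m) :
    Sum.elim (fun _ : Unit => t) x ⬝ᵥ (P.matAA i *ᵥ Sum.elim (fun _ => t) x) =
      (P.A *ᵥ x) i ^ 2 := by
  rw [matAA, fromBlocks_mulVec, Sum.elim_comp_inl, Sum.elim_comp_inr, sumElim_dotProduct_sumElim]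
  simp [vecMulVec_mulVec, mulVec, dotProduct_comm x, sq]

theorem quad_matN (j : Fin n) :
    Sum.elim (fun _ : Unit => t) x ⬝ᵥ (matN j *ᵥ Sum.elim (fun _ => t) x) =
      2 * x j * (x j - t) := by
  rw [matN, fromBlocks_mulVec, Sum.elim_comp_inl, Sum.elim_comp_inr, sumElim_dotProduct_sumElim, dotProduct_add]
  have h1 : (replicateCol Unit (-Pi.single j 1 : Fin n → ℝ) *ᵥ fun _ => t) =
      (-t) • Pi.single j 1 := by
    ext i; simp [mulVec, dotProduct, mul_comm]
  have h2 : (replicateRow Unit (-Pi.single j 1 : Fin n → ℝ) *ᵥ x) = fun _ => - x j := by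
    ext i
    rw [replicateRow_mulVec_eq_const]
    simp
  rw [h1, h2, dotProduct_add x, dotProduct_smul, smul_mulVec, vecMulVec_mulVec]
  simp [dotProduct_smul]
  ring

theorem dotProduct_sum_mulVec {ι κ : Type*} [Fintype κ] (s : Finset ι) (M : ι → Matrix κ κ ℝ)
    (y : κ → ℝ) : y ⬝ᵥ ((∑ i ∈ s, M i) *ᵥ y) = ∑ i ∈ s, y ⬝ᵥ (M i *ᵥ y) := by
  rw [sum_mulVec, dotProduct_sum]

theorem quad_sum_matKK :
    Sum.elim (fun _ : Unit => t) x ⬝ᵥ ((∑ i, P.matKK i) *ᵥ Sum.elim (fun _ => t) x) =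
      ∑ i, ((P.A *ᵥ x) i - P.b i * t) ^ 2 := by
  rw [dotProduct_sum_mulVec]
  refine Finset.sum_congr rfl fun i _ => ?_
  simp only [matKK, add_mulVec, sub_mulVec, smul_mulVec, dotProduct_add, dotProduct_sub,
    dotProduct_smul, quad_matT, quad_matA, quad_matAA, smul_eq_mul]
  ring

theorem quad_matG (j : Fin n) (f g r : ℝ) :
    Sum.elim (fun _ : Unit => t) x ⬝ᵥ (P.matG j f g r *ᵥ Sum.elim (fun _ => t) x) =
      f * ∑ i, ((P.A *ᵥ x) i - P.b i * t) ^ 2 - g * (2 * x j * (x j - t)) + r * t ^ 2 := by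
  simp only [matG, add_mulVec, sub_mulVec, smul_mulVec, dotProduct_add, dotProduct_sub,
    dotProduct_smul, quad_matT, quad_matN, quad_sum_matKK, smul_eq_mul]

theorem quad_matU (f₁ f₂ g r τ l : ℝ) :
    Sum.elim (fun _ : Unit => t) x ⬝ᵥ (P.matU f₁ f₂ g r τ l *ᵥ Sum.elim (fun _ => t) x) =
      x ⬝ᵥ (P.Q *ᵥ x) + 2 * t * (P.c ⬝ᵥ x) + f₁ * ∑ i, ((P.A *ᵥ x) i - P.b i * t) ^ 2 +
      ∑ j ∈ P.B, (f₂ * ∑ i, ((P.A *ᵥ x) i - P.b i * t) ^ 2 - g * (2 * x j * (x j - t)) +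
        r * t ^ 2) + τ * (t ^ 2 + ∑ i, (P.A *ᵥ x) i ^ 2) - l * t ^ 2 := by
  simp only [matU, matH, add_mulVec, sub_mulVec, smul_mulVec, dotProduct_add, dotProduct_sub,
    dotProduct_smul, quad_matT, quad_matC, quad_sum_matKK, dotProduct_sum_mulVec P.B,
    dotProduct_sum_mulVec _ P.matAA, quad_matG, quad_matAA, smul_eq_mul]

theorem quad_dualMatrix (d : P.DualVar) :
    Sum.elim (fun _ : Unit => t) x ⬝ᵥ (P.dualMatrix d *ᵥ Sum.elim (fun _ => t) x) =
      x ⬝ᵥ (P.Q *ᵥ x) + 2 * t * (P.c ⬝ᵥ x) +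
      ∑ i, (d.α i * (2 * t * (P.A *ᵥ x) i) + d.β i * (P.A *ᵥ x) i ^ 2) +
      ∑ j : P.B, d.γ j * (2 * x j * (x j - t)) + d.θ * t ^ 2 := by
  simp only [dualMatrix, add_mulVec, smul_mulVec, dotProduct_add,
    dotProduct_smul, quad_matT, quad_matC, dotProduct_sum_mulVec,
    quad_matA, quad_matN, quad_matAA, smul_eq_mul]

end QuadraticForms

theorem isSymm_matT : (matT n).IsSymm :=
  IsSymm.fromBlocks (by simp) (by simp) (by simp)

theorem isSymm_matA (i : Fin m) : (P.matA i).IsSymm :=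
  IsSymm.fromBlocks (by simp) (by simp) (by simp)

theorem isSymm_matAA (i : Fin m) : (P.matAA i).IsSymm :=
  IsSymm.fromBlocks (by simp) (by simp) (by simp [IsSymm, transpose_vecMulVec])

theorem isSymm_matN (j : Fin n) : (matN j).IsSymm :=
  IsSymm.fromBlocks (by simp) (by simp) (by simp [IsSymm, transpose_vecMulVec])

theorem isSymm_matC (hQ : P.Q.IsSymm) : P.matC.IsSymm :=
  IsSymm.fromBlocks (by simp) (by simp) hQ

theorem isSymm_sum {ι κ : Type*} (s : Finset ι) (M : ι → Matrix κ κ ℝ)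
    (h : ∀ i ∈ s, (M i).IsSymm) : (∑ i ∈ s, M i).IsSymm := by
  rw [IsSymm, transpose_sum]
  exact Finset.sum_congr rfl h

theorem isSymm_sum_matKK : (∑ i, P.matKK i).IsSymm :=
  isSymm_sum _ _ fun i _ => ((isSymm_matT.smul _).sub ((P.isSymm_matA i).smul _)).add
    (P.isSymm_matAA i)

theorem isSymm_matG (j : Fin n) (f g r : ℝ) : (P.matG j f g r).IsSymm :=
  ((P.isSymm_sum_matKK.smul _).sub ((isSymm_matN j).smul _)).add (isSymm_matT.smul _)

theorem isSymm_matU (hQ : P.Q.IsSymm) (f₁ f₂ g r τ l : ℝ) : (P.matU f₁ f₂ g r τ l).IsSymm :=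
  (((((P.isSymm_matC hQ).add (P.isSymm_sum_matKK.smul _)).add
    (isSymm_sum _ _ fun j _ => P.isSymm_matG j _ _ _)).add
    ((isSymm_matT.add (isSymm_sum _ _ fun i _ => P.isSymm_matAA i)).smul _)).sub
    (isSymm_matT.smul _))

/-- A form that is nonnegative on the slices `t = 0` and `t = 1` of the nonnegative orthant is
copositive. -/
theorem isCopositive_of_slices {M : Matrix (Unit ⊕ Fin n) (Unit ⊕ Fin n) ℝ} (hM : M.IsSymm)
    (h0 : ∀ x : Fin n → ℝ, 0 ≤ x →
      0 ≤ Sum.elim (fun _ : Unit => (0 : ℝ)) x ⬝ᵥ (M *ᵥ Sum.elim (fun _ => 0) x))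
    (h1 : ∀ x : Fin n → ℝ, 0 ≤ x →
      0 ≤ Sum.elim (fun _ : Unit => (1 : ℝ)) x ⬝ᵥ (M *ᵥ Sum.elim (fun _ => 1) x)) :
    IsCopositive M := by
  refine ⟨hM, fun y hy => ?_⟩
  have hx : 0 ≤ fun i => y (Sum.inr i) := fun i => hy _
  rcases (hy (Sum.inl ())).eq_or_lt with ht | ht
  · have hy' : y = Sum.elim (fun _ : Unit => (0 : ℝ)) fun i => y (Sum.inr i) := by
      ext (_ | i)
      · exact ht.symm
      · rfl
    rw [hy']
    exact h0 _ hx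
  · simp only [Pi.zero_apply] at ht
    have hy' : y = y (Sum.inl ()) • Sum.elim (fun _ : Unit => (1 : ℝ))
        ((y (Sum.inl ()))⁻¹ • fun i => y (Sum.inr i)) := by
      ext (_ | i)
      · simp
      · simp [ht.ne']
    rw [hy', mulVec_smul, dotProduct_smul, smul_dotProduct, smul_eq_mul, smul_eq_mul]
    have := h1 ((y (Sum.inl ()))⁻¹ • fun i => y (Sum.inr i))
      (smul_nonneg (inv_nonneg.2 ht.le) hx)
    positivity

theorem dualMatrix_eq_matU (f₁ f₂ g r τ l : ℝ) :
    ∃ d : P.DualVar, P.dualMatrix d = P.matU f₁ f₂ g r τ l := by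
  refine ⟨⟨fun i => -(f₁ + P.B.card * f₂) * P.b i, fun _ => f₁ + P.B.card * f₂ + τ,
    fun _ => -g, (f₁ + P.B.card * f₂) * ∑ i, P.b i ^ 2 + P.B.card * r + τ - l⟩, ?_⟩
  have hN : ∑ j : P.B, (-g) • matN (j : Fin n) = -(g • ∑ j ∈ P.B, matN j) := by
    rw [Finset.sum_coe_sort P.B fun j => (-g) • matN j, ← Finset.smul_sum, neg_smul]
  have hK : ∑ i, P.matKK i = (∑ i, P.b i ^ 2) • matT n - ∑ i, P.b i • P.matA i +
      ∑ i, P.matAA i := by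
    simp only [matKK, Finset.sum_add_distrib, Finset.sum_sub_distrib, Finset.sum_smul]
  have hA : ∀ a : ℝ, ∑ i, (a * P.b i) • P.matA i = a • ∑ i, P.b i • P.matA i := by
    intro a
    simp only [mul_smul, Finset.smul_sum]
  simp only [dualMatrix, matU, matG, matH, hN, Finset.sum_add_distrib, Finset.sum_sub_distrib, hA,
    ← Finset.smul_sum, Finset.sum_const, hK, ← Nat.cast_smul_eq_nsmul ℝ]
  module

theorem dualObjective_eq {x : Fin n → ℝ} (hx : x ∈ P.feasible) {f₁ f₂ g r τ l : ℝ}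
    (d : P.DualVar) (hd : P.dualMatrix d = P.matU f₁ f₂ g r τ l) :
    P.dualObjective d = l - τ * (1 + ∑ i, P.b i ^ 2) - r * (P.B.card : ℝ) := by
  obtain ⟨⟨-, hA⟩, hbin⟩ := hx
  have hzero : ∀ j ∈ P.B, 2 * x j * (x j - 1) = 0 := by
    intro j hj
    rcases hbin j hj with h | h <;> simp [h]
  have h1 := P.quad_dualMatrix 1 x d
  have hB : ∑ j : P.B, d.γ j * (2 * x j * (x j - 1)) = 0 :=
    Finset.sum_eq_zero fun j _ => by rw [hzero j j.2, mul_zero]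
  have hG : ∑ j ∈ P.B, (f₂ * ∑ i, (P.b i - P.b i * 1) ^ 2 - g * (2 * x j * (x j - 1)) +
      r * 1 ^ 2) = P.B.card * r := by
    rw [Finset.sum_congr rfl fun j hj => by rw [hzero j hj]]
    simp
  rw [hd, quad_matU, hA, hB, hG] at h1
  have h2 : ∑ i, (2 * P.b i * d.α i + P.b i ^ 2 * d.β i) =
      ∑ i, (d.α i * (2 * 1 * P.b i) + d.β i * P.b i ^ 2) :=
    Finset.sum_congr rfl fun i _ => by ring
  rw [dualObjective, h2]
  simp at h1
  simp
  linarith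

theorem hConst_mul_le {j : Fin n} {x : Fin n → ℝ} (hx : 0 ≤ x) (hxj : 0 < x j) :
    P.hConst j 1 * x j ≤ ‖P.A *ᵥ x‖ := by
  have h := P.hConst_le (j := j) (δ := 1) (x := (x j)⁻¹ • x)
    (smul_nonneg (inv_nonneg.2 hxj.le) hx) (by simp [hxj.ne'])
  rwa [mulVec_smul, norm_smul, norm_inv, Real.norm_eq_abs, abs_of_pos hxj, inv_mul_eq_div,
    le_div_iff₀ hxj] at h

theorem isCopositive_matG {j : Fin n} {f g r : ℝ} (hr : 0 < r) (hg : 0 < g)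
    (hh : 0 < P.hConst j 1) (hp : 0 < P.pConst j r g) (hf₁ : 2 * g / P.hConst j 1 ^ 2 ≤ f)
    (hf₂ : (g ^ 2 + 2 * r * g) / (r * P.pConst j r g ^ 2) ≤ f) :
    IsCopositive (P.matG j f g r) := by
  have hf : 0 < f := lt_of_lt_of_le (by positivity) hf₁
  refine isCopositive_of_slices (P.isSymm_matG j f g r) (fun x hx => ?_) (fun x hx => ?_)
  · rw [quad_matG]
    simp only [mul_zero, sub_zero, ne_eq, OfNat.ofNat_ne_zero, not_false_eq_true, zero_pow,
      add_zero]
    rcases (hx j).eq_or_lt with h0 | h0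
    · rw [← h0]
      have : 0 ≤ f * ∑ i, (P.A *ᵥ x) i ^ 2 :=
        mul_nonneg hf.le (Finset.sum_nonneg fun i _ => sq_nonneg _)
      simpa using this
    · simp only [Pi.zero_apply] at h0
      have h1 : (P.hConst j 1 * x j) ^ 2 ≤ ∑ i, (P.A *ᵥ x) i ^ 2 :=
        (pow_le_pow_left₀ (by positivity) (P.hConst_mul_le hx h0) 2).trans (norm_sq_le_sum_sq _)
      rw [div_le_iff₀ (by positivity)] at hf₁
      have h2 := mul_le_mul_of_nonneg_right hf₁ (sq_nonneg (x j))
      have h3 := mul_le_mul_of_nonneg_left h1 hf.le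
      nlinarith
  · rw [quad_matG]
    simp only [mul_one, one_pow]
    have hS : ‖P.A *ᵥ x - P.b‖ ^ 2 ≤ ∑ i, ((P.A *ᵥ x) i - P.b i) ^ 2 :=
      norm_sq_le_sum_sq (P.A *ᵥ x - P.b)
    have hfS := mul_le_mul_of_nonneg_left hS hf.le
    have hf0 : 0 ≤ f * ‖P.A *ᵥ x - P.b‖ ^ 2 := by positivity
    obtain ⟨v, hv⟩ : ∃ v, x j = 1 + v := ⟨x j - 1, by ring⟩
    have hxj : 0 ≤ 1 + v := hv ▸ hx j
    rw [hv]
    rcases le_total v 0 with hv0 | hv0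
    · have : g * (2 * (1 + v) * (1 + v - 1)) ≤ 0 :=
        mul_nonpos_of_nonneg_of_nonpos hg.le
          (mul_nonpos_of_nonneg_of_nonpos (by linarith) (by linarith))
      linarith
    rcases le_total v (min (r / (4 * g)) 1) with hvm | hvm
    · have h1 : v * (4 * g) ≤ r := (le_div_iff₀ (by positivity)).1 (hvm.trans (min_le_left _ _))
      have h2 : v ≤ 1 := hvm.trans (min_le_right _ _)
      have h3 : g * v * v ≤ g * v * 1 := mul_le_mul_of_nonneg_left h2 (by positivity)
      nlinarith
    · have hvpos : 0 < v := (lt_min (by positivity) one_pos).trans_le hvm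
      have h1 := P.pConst_le hr hg hx hv.ge hvm
      rw [le_div_iff₀ hvpos] at h1
      have h2 : (P.pConst j r g * v) ^ 2 ≤ ‖P.A *ᵥ x - P.b‖ ^ 2 :=
        pow_le_pow_left₀ (by positivity) h1 2
      rw [div_le_iff₀ (by positivity)] at hf₂
      have h3 : (g ^ 2 / r + 2 * g) * v ^ 2 ≤ f * ‖P.A *ᵥ x - P.b‖ ^ 2 := by
        have h4 : g ^ 2 / r + 2 * g ≤ f * P.pConst j r g ^ 2 := by
          rw [div_add' _ _ _ hr.ne', div_le_iff₀ hr]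
          linarith
        calc (g ^ 2 / r + 2 * g) * v ^ 2 ≤ f * P.pConst j r g ^ 2 * v ^ 2 := by gcongr
          _ = f * (P.pConst j r g * v) ^ 2 := by ring
          _ ≤ _ := by gcongr
      have h5 : 0 ≤ (g * v - r) ^ 2 / r := by positivity
      have h6 : (g * v - r) ^ 2 / r = g ^ 2 / r * v ^ 2 - 2 * (g * v) + r := by
        field_simp; ring
      linarith

variable {ρ η l t₁ t₂ ε₀ r f₁ f₂ g τ : ℝ}

theorem isCopositive_matU (hQ : P.Q.IsSymm) (hQ0 : ∀ x, 0 ≤ x ⬝ᵥ (P.Q *ᵥ x))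
    (hf₁ : 0 ≤ f₁) (hτ : τ = t₂ * ε₀) (hε₀ : 0 < ε₀) (hε₁ : ε₀ < t₁) (hr : 0 ≤ r)
    (hg0 : 0 ≤ g) (hstab : P.IsLocallyStable l t₁ t₂)
    (hlow : ∀ x : Fin n → ℝ, 0 ≤ x → -ρ ≤ P.objective x + f₁ * ‖P.A *ᵥ x - P.b‖ ^ 2)
    (hlow' : ∀ x : Fin n → ℝ, 0 ≤ x → ρ + l ≤ f₁ * ‖P.A *ᵥ x - P.b‖ ^ 2 →
      l ≤ P.objective x + f₁ * ‖P.A *ᵥ x - P.b‖ ^ 2)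
    (hG : ∀ j ∈ P.B, IsCopositive (P.matG j f₂ g r))
    (hf₂ : 0 ≤ f₂ ∨ P.B = ∅)
    (hfε : (ρ + l) / ε₀ ^ 2 ≤ f₁)
    (hfu : ∀ j ∈ P.B, 0 < P.uConst j ε₀ ∧ (ρ + l) / P.uConst j ε₀ ^ 2 ≤ f₁)
    (hg : (ρ + l) / ε₀ ^ 2 ≤ g) :
    IsCopositive (P.matU f₁ f₂ g r τ l) := by
  have ht₂ := hstab.2.1
  have hτ0 : 0 < τ := by rw [hτ]; positivity
  have hsq : ∀ u : Fin m → ℝ, 0 ≤ ∑ i, u i ^ 2 := fun u => Finset.sum_nonneg fun i _ => sq_nonneg _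
  refine isCopositive_of_slices (P.isSymm_matU hQ _ _ _ _ _ _) (fun x hx => ?_) (fun x hx => ?_)
  · rw [quad_matU]
    have hsum : 0 ≤ ∑ j ∈ P.B, (f₂ * ∑ i, ((P.A *ᵥ x) i - P.b i * 0) ^ 2 -
        g * (2 * x j * (x j - 0)) + r * 0 ^ 2) :=
      Finset.sum_nonneg fun j hj => by
        rw [← quad_matG]
        refine (hG j hj).2 _ ?_
        rintro (_ | i)
        · exact le_rfl
        · exact hx i
    have h1 := mul_nonneg hf₁ (hsq fun i => (P.A *ᵥ x) i - P.b i * 0)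
    have h2 := mul_nonneg hτ0.le (hsq (P.A *ᵥ x))
    linarith [hQ0 x]
  · rw [quad_matU]
    have hGj : ∀ j ∈ P.B, 0 ≤ f₂ * ∑ i, ((P.A *ᵥ x) i - P.b i * 1) ^ 2 -
        g * (2 * x j * (x j - 1)) + r * 1 ^ 2 := fun j hj => by
      rw [← quad_matG]
      refine (hG j hj).2 _ ?_
      rintro (_ | i)
      · exact zero_le_one
      · exact hx i
    have hsum := Finset.sum_nonneg hGj
    have hobj : P.objective x = x ⬝ᵥ (P.Q *ᵥ x) + 2 * 1 * (P.c ⬝ᵥ x) := by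
      rw [objective, mul_one]
    have hS : ‖P.A *ᵥ x - P.b‖ ^ 2 ≤ ∑ i, ((P.A *ᵥ x) i - P.b i * 1) ^ 2 := by
      simpa using norm_sq_le_sum_sq (P.A *ᵥ x - P.b)
    have hfS := mul_le_mul_of_nonneg_left hS hf₁
    have hf0 : 0 ≤ f₁ * ‖P.A *ᵥ x - P.b‖ ^ 2 := by positivity
    have hτA := mul_nonneg hτ0.le (hsq (P.A *ᵥ x))
    have hstep : ∀ a : ℝ, 0 < a → (ρ + l) / a ^ 2 ≤ f₁ → a ≤ ‖P.A *ᵥ x - P.b‖ →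
        l ≤ P.objective x + f₁ * ‖P.A *ᵥ x - P.b‖ ^ 2 := fun a ha h1 h2 => by
      rw [div_le_iff₀ (by positivity)] at h1
      exact hlow' x hx (h1.trans (by gcongr))
    rcases le_or_gt ε₀ ‖P.A *ᵥ x - P.b‖ with hres | hres
    · linarith [hstep ε₀ hε₀ hfε hres]
    by_cases hu : ∃ j ∈ P.B, 1 + ε₀ ≤ x j
    · obtain ⟨j, hj, hxj⟩ := hu
      linarith [hstep _ (hfu j hj).1 (hfu j hj).2 (P.uConst_le hx hxj)]
    push Not at hu
    by_cases hmid : ∃ j ∈ P.B, ε₀ < x j ∧ x j < 1 - ε₀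
    · obtain ⟨j, hj, h1, h2⟩ := hmid
      have hf₂' : 0 ≤ f₂ := hf₂.resolve_right (Finset.ne_empty_of_mem hj)
      have h3 := Finset.single_le_sum hGj hj
      have h4 : 0 ≤ f₂ * ∑ i, ((P.A *ᵥ x) i - P.b i * 1) ^ 2 := mul_nonneg hf₂' (hsq _)
      have h5 : ε₀ ^ 2 ≤ x j * (1 - x j) := by nlinarith
      have h6 := mul_le_mul_of_nonneg_left h5 hg0
      rw [div_le_iff₀ (by positivity)] at hg
      have h7 : 0 ≤ g * ε₀ ^ 2 := by positivity
      linarith [hlow x hx]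
    · push Not at hmid
      have hmem : x ∈ P.perturbedFeasible ε₀ := by
        classical
        refine ⟨hx, P.A *ᵥ x - P.b, fun j => (if x j ≤ ε₀ then 0 else 1) - x j,
          fun i => (norm_le_pi_norm (P.A *ᵥ x - P.b) i).trans hres.le, fun j => ?_, by simp,
          fun j => ?_⟩
        · have h0 : 0 ≤ x j := hx j
          simp only
          split_ifs with h
          · rw [abs_le]; constructor <;> linarith
          · have h1 := hmid j j.2 (not_le.1 h)
            have h2 := hu j j.2
            rw [abs_le]; constructor <;> linarith
        · simp only [add_sub_cancel]
          split_ifs <;> simp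
      have h1 := P.objective_le_of_isLocallyStable hstab hε₀.le hε₁ hmem
      rw [← hτ] at h1
      linarith

theorem exists_penaltyRules (P : MBQP m n) (ρ η l t₂ ε₀ r : ℝ) :
    ∃ f₁ f₂ g τ : ℝ, P.PenaltyRules ρ η l t₂ ε₀ r f₁ f₂ g τ := by
  have hbdd : ∀ F : Fin n → ℝ, ∃ M : ℝ, ∀ j, F j ≤ M := fun F =>
    (Set.finite_range F).bddAbove.imp fun M hM j => hM ⟨j, rfl⟩
  obtain ⟨g, hg0, hg⟩ : ∃ g : ℝ, 0 < g ∧ (ρ + l) / ε₀ ^ 2 ≤ g :=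
    ⟨max 1 _, lt_max_of_lt_left one_pos, le_max_right _ _⟩
  obtain ⟨M₁, h₁⟩ := hbdd fun j => 2 * g / P.hConst j 1 ^ 2
  obtain ⟨M₂, h₂⟩ := hbdd fun j => 2 * g / P.pConst j r g ^ 2
  obtain ⟨M₃, h₃⟩ := hbdd fun j => (g ^ 2 + 2 * r * g) / (r * P.pConst j r g ^ 2)
  obtain ⟨M₄, h₄⟩ := hbdd fun j => (ρ + l) / P.uConst j ε₀ ^ 2
  exact ⟨max (max (ρ + l) (1 / (2 * η))) (max ((ρ + l) / ε₀ ^ 2) M₄), max M₁ (max M₂ M₃), g, _,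
    hg0, fun j _ => ⟨(h₁ j).trans (le_max_left _ _),
      (h₂ j).trans ((le_max_left _ _).trans (le_max_right _ _)),
      (h₃ j).trans ((le_max_right _ _).trans (le_max_right _ _))⟩, rfl,
    ⟨(le_max_left _ _).trans (le_max_left _ _), (le_max_right _ _).trans (le_max_left _ _),
      (le_max_left _ _).trans (le_max_right _ _),
      fun j _ => (h₄ j).trans ((le_max_right _ _).trans (le_max_right _ _))⟩, hg⟩

theorem tendsto_dualValue (l t₂ s k : ℝ) :
    Tendsto (fun q : ℝ × ℝ => l - (t₂ * q.1) * s - q.2 * k) (𝓝[>] 0 ×ˢ 𝓝[>] 0) (𝓝 l) := by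
  have hc : Continuous fun q : ℝ × ℝ => l - (t₂ * q.1) * s - q.2 * k := by fun_prop
  have h := hc.tendsto (0, 0)
  simp only [mul_zero, zero_mul, sub_zero, nhds_prod_eq] at h
  exact h.mono_left (Filter.prod_mono nhdsWithin_le_nhds nhdsWithin_le_nhds)

end MBQP

theorem mainTheorem4 {m n : ℕ} (P : MBQP m n)
    (hQ : P.Q.PosSemidef)
    (hB : P.BinaryInUnitInterval)
    (hfeas : P.feasible.Nonempty) :
    (∃ t₁ t₂ : ℝ, 0 < t₁ ∧ 0 < t₂ ∧
      ∀ l : ℝ, (l : EReal) ≤ P.optVal → P.IsLocallyStable l t₁ t₂) ∧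
    (∃ ρ η : ℝ, 0 < ρ ∧ 0 < η ∧
      ∀ l : ℝ, (l : EReal) ≤ P.optVal →
      ∀ t₁ t₂ : ℝ, P.IsLocallyStable l t₁ t₂ →
        (∀ ε₀ r : ℝ, 0 < ε₀ → ε₀ < t₁ → 0 < r →
          (∀ j ∈ P.B, 0 < P.uConst j ε₀ ∧ 0 < P.hConst j 1 ∧
            ∀ g : ℝ, 0 < g → 0 < P.pConst j r g) ∧
          (∃ f₁ f₂ g τ : ℝ, P.PenaltyRules ρ η l t₂ ε₀ r f₁ f₂ g τ) ∧
          (∀ f₁ f₂ g τ : ℝ, P.PenaltyRules ρ η l t₂ ε₀ r f₁ f₂ g τ →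
            (∀ j ∈ P.B, IsCopositive (P.matG j f₂ g r)) ∧
            IsCopositive (P.matU f₁ f₂ g r τ l) ∧
            (∃ d : P.DualVar, P.dualMatrix d = P.matU f₁ f₂ g r τ l) ∧
            (∀ d : P.DualVar, P.dualMatrix d = P.matU f₁ f₂ g r τ l →
              P.dualObjective d
                = l - τ * (1 + ∑ i, P.b i ^ 2) - r * (P.B.card : ℝ)))) ∧
        Tendsto
          (fun q : ℝ × ℝ =>
            l - (t₂ * q.1) * (1 + ∑ i, P.b i ^ 2) - q.2 * (P.B.card : ℝ))
          (𝓝[>] 0 ×ˢ 𝓝[>] 0) (𝓝 l)) := by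
  refine ⟨P.exists_stability_constants hQ hB hfeas, ?_⟩
  by_cases hex : ∃ l : ℝ, (l : EReal) ≤ P.optVal
  swap
  · exact ⟨1, 1, one_pos, one_pos, fun l hl => (hex ⟨l, hl⟩).elim⟩
  obtain ⟨l₀, hl₀⟩ := hex
  have hsymm : P.Q.IsSymm := by simpa using hQ.isHermitian
  have hQ0 : ∀ x, 0 ≤ x ⬝ᵥ (P.Q *ᵥ x) := fun x => by simpa using hQ.dotProduct_mulVec_nonneg x
  obtain ⟨κ, R, hκ, hR, hlow⟩ := P.exists_objective_lower_bound hQ fun d h1 h2 h3 =>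
    P.recession_cost_nonneg hB hfeas (P.le_optVal_iff.1 hl₀) hsymm h1 h2 h3
  obtain ⟨x₀, hx₀⟩ := hfeas
  have hpoly : P.polyhedron.Nonempty := ⟨x₀, hx₀.1⟩
  refine ⟨2 * R + |P.objective x₀|, 1 / 2, by positivity, by norm_num,
    fun l hl t₁ t₂ hstab => ⟨fun ε₀ r hε₀ hε₁ hr => ?_, MBQP.tendsto_dualValue _ _ _ _⟩⟩
  have hpos : ∀ j ∈ P.B, 0 < P.uConst j ε₀ ∧ 0 < P.hConst j 1 ∧
      ∀ g : ℝ, 0 < g → 0 < P.pConst j r g := fun j hj =>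
    ⟨P.uConst_pos hB hpoly hj hε₀, P.hConst_pos hB hpoly hj one_pos,
      fun g hg => P.pConst_pos hB hpoly hj hr hg⟩
  refine ⟨hpos, P.exists_penaltyRules _ _ _ _ _ _, fun f₁ f₂ g τ h => ?_⟩
  have hf₁ : 1 ≤ f₁ := by simpa using h.f₁_ge.2.1
  have hG : ∀ j ∈ P.B, IsCopositive (P.matG j f₂ g r) := fun j hj =>
    P.isCopositive_matG hr h.g_pos (hpos j hj).2.1 ((hpos j hj).2.2 g h.g_pos)
      (h.f₂_ge j hj).1 (h.f₂_ge j hj).2.2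
  have hbound : ∀ x : Fin n → ℝ, 0 ≤ x →
      -R ≤ P.objective x + 1 / 2 * ‖P.A *ᵥ x - P.b‖ ^ 2 := fun x hx => by
    have h1 : 0 ≤ κ * ‖P.Q *ᵥ x‖ ^ 2 := by positivity
    linarith [hlow x hx]
  have hle : ∀ x : Fin n → ℝ, ‖P.A *ᵥ x - P.b‖ ^ 2 ≤ f₁ * ‖P.A *ᵥ x - P.b‖ ^ 2 := fun x =>
    le_mul_of_one_le_left (sq_nonneg _) hf₁
  have hl₁ : l ≤ |P.objective x₀| := (P.le_optVal_iff.1 hl x₀ hx₀).trans (le_abs_self _)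
  refine ⟨hG, P.isCopositive_matU hsymm hQ0 (by linarith) h.τ_eq hε₀ hε₁ hr.le h.g_pos.le hstab
    (fun x hx => ?_) (fun x hx h1 => ?_) hG ?_ h.f₁_ge.2.2.1
    (fun j hj => ⟨(hpos j hj).1, h.f₁_ge.2.2.2 j hj⟩) h.g_ge, P.dualMatrix_eq_matU _ _ _ _ _ _,
    fun d hd => P.dualObjective_eq hx₀ d hd⟩
  · linarith [hbound x hx, hle x, sq_nonneg ‖P.A *ᵥ x - P.b‖, abs_nonneg (P.objective x₀)]
  · linarith [hbound x hx, hle x]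
  · rcases P.B.eq_empty_or_nonempty with hB0 | ⟨j, hj⟩
    · exact Or.inr hB0
    · have hg0 := h.g_pos
      exact Or.inl (le_trans (by positivity) (h.f₂_ge j hj).1)
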